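/- Let $\Gamma$ be a distance-regular graph with finite vertex set $X$ and diameter $D\ge 3$; that is, $\Gamma$ is a finite simple connected graph with path-length distance $\partial$ such that for $0\le h,i,j\le D$ and $y,z\in X$ with $\partial(y,z)=h$ the number $|\{w\in X : \partial(y,w)=i,\ \partial(z,w)=j\}|$ depends only on $h,i,j$. Assume that $E_0,\dots,E_D$ is a $Q$-polynomial ordering of the primitive idempotents of the adjacency matrix of $\Gamma$. This means the following: the adjacency matrix has exactly $D+1$ distinct eigenvalues $\theta_0,\dots,\theta_D$ with $\theta_0$ the valency of $\Gamma$; $E_i\in \mathrm{Mat}_X(\mathbb R)$ acts as the identity on the $\theta_i$-eigenspace and as $0$ on the other eigenspaces; and the scalars $q^h_{i,j}$ defined by $E_i\circ E_j=|X|^{-1}\sum_{h=0}^D q^h_{i,j}E_h$ (with $\circ$ the entrywise product) satisfy $q^h_{i,j}=0$ if one of $h,i,j$ is greater than the sum of the other two, and $q^h_{i,j}\neq 0$ if one of $h,i,j$ equals the sum of the other two. Fix $x\in X$. For $\mathbb F\in\{\mathbb R,\mathbb C\}$ let $T^{\mathbb F}=T^{\mathbb F}(x)$ be the subalgebra of $\mathrm{Mat}_X(\mathbb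 F)$ generated by the distance matrices $A_i$ (with $(y,z)$-entry $1$ if $\partial(y,z)=i$ and $0$ otherwise) and the diagonal matrices $E_i^*$ (with $(y,y)$-entry $1$ if $\partial(x,y)=i$ and $0$ otherwise), $0\le i\le D$. A $T^{\mathbb R}$-module is a $T^{\mathbb R}$-invariant subspace of $\mathbb R^X$. It is irreducible if it is nonzero and contains no $T^{\mathbb R}$-modules other than $0$ and itself. The complexification of a $T^{\mathbb R}$-module $W$ is $W^{\mathbb C}=W\otimes_{\mathbb R}\mathbb C$, on which $T^{\mathbb C}=T^{\mathbb R}+\boldsymbol{i}\,T^{\mathbb R}$ acts by $(B_1+\boldsymbol{i}B_2)(w\otimes c)=B_1w\otimes c+B_2w\otimes \boldsymbol{i}c$ for $B_1,B_2\in T^{\mathbb R}$. **Theorem.** Let $W_1,W_2$ be irreducible $T^{\mathbb R}$-modules. Then $W_1$ and $W_2$ are isomorphic as $T^{\mathbb R}$-modules if and only if $W_1^{\mathbb C}$ and $W_2^{\mathbb C}$ are isomorphic as $T^{\mathbb C}$-modules. -/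

import Mathlib

open scoped TensorProduct Matrix

noncomputable section

namespace Terwilliger

/-- A finite connected graph is distance-regular if, for all `0 ≤ h, i, j ≤ D` (with `D` the
diameter), the number `p^h_{i,j} = |Γ_i(y) ∩ Γ_j(z)|` is the same for all vertices `y, z` at
distance `h`. -/
structure IsDistanceRegular {X : Type*} (G : SimpleGraph X) : Prop where
  connected : G.Connected
  exists_intersection_number : ∀ h i j : ℕ, h ≤ G.diam → i ≤ G.diam → j ≤ G.diam →
    ∃ p : ℕ, ∀ y z : X, G.dist y z = h → {w : X | G.dist y w = i ∧ G.dist z w = j}.ncard = p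

/-- The `i`-th distance matrix `A_i`; the adjacency matrix is `A = A_1`. -/
def distMatrix (F : Type*) [Field F] {X : Type*} (G : SimpleGraph X) (i : ℕ) : Matrix X X F :=
  Matrix.of fun y z => if G.dist y z = i then 1 else 0

/-- The `i`-th dual primitive idempotent `E_i^*` with respect to the vertex `x`. -/
def dualIdempotent (F : Type*) [Field F] {X : Type*} [DecidableEq X] (G : SimpleGraph X) (x : X)
    (i : ℕ) : Matrix X X F :=
  Matrix.diagonal fun y => if G.dist x y = i then 1 else 0

/-- The Bose-Mesner algebra `M`, as the span of the distance matrices `A_0, …, A_D`. -/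
def boseMesner (F : Type*) [Field F] {X : Type*} (G : SimpleGraph X) :
    Submodule F (Matrix X X F) :=
  Submodule.span F {B | ∃ i ≤ G.diam, B = distMatrix F G i}

/-- The dual Bose-Mesner algebra `M^* = M^*(x)`, as the span of `E_0^*, …, E_D^*`. -/
def dualBoseMesner (F : Type*) [Field F] {X : Type*} [DecidableEq X] (G : SimpleGraph X)
    (x : X) : Submodule F (Matrix X X F) :=
  Submodule.span F {B | ∃ i ≤ G.diam, B = dualIdempotent F G x i}

/-- The Terwilliger algebra `T^F = T^F(x)`: the subalgebra of `Mat_X(F)` generated by `M` and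
`M^*(x)`. It acts on the standard module `X → F` by `Matrix.mulVec`; a `T^F`-module is a
`T^F`-submodule of `X → F`. -/
def algebraT (F : Type*) [Field F] {X : Type*} [Fintype X] [DecidableEq X] (G : SimpleGraph X)
    (x : X) : Subalgebra F (Matrix X X F) :=
  Algebra.adjoin F ((boseMesner F G : Set (Matrix X X F)) ∪ dualBoseMesner F G x)

/-- `E_0, …, E_D` is an ordering of the primitive idempotents of (the adjacency matrix `A` of)
`G`: there are mutually distinct `θ_0, …, θ_D`, which are exactly the eigenvalues of `A`, with
`θ_0` the valency, such that `E_i` is the identity on the `θ_i`-eigenspace and zero on the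
`θ_j`-eigenspaces with `j ≠ i`. -/
def IsPrimitiveIdempotentOrdering {X : Type*} [Fintype X] [DecidableEq X] (G : SimpleGraph X)
    (E : Fin (G.diam + 1) → Matrix X X ℝ) : Prop :=
  ∃ θ : Fin (G.diam + 1) → ℝ,
    Function.Injective θ ∧
    (∀ μ : ℝ, Module.End.HasEigenvalue (Matrix.toLin' (distMatrix ℝ G 1)) μ ↔ ∃ i, θ i = μ) ∧
    (∀ y : X, θ 0 = ((G.neighborSet y).ncard : ℝ)) ∧
    ∀ i j, ∀ v ∈ Module.End.eigenspace (Matrix.toLin' (distMatrix ℝ G 1)) (θ j),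
      E i *ᵥ v = if i = j then v else 0

/-- `q` is the family of Krein parameters `q^h_{i,j}` (written `q h i j`) of the ordering `E`:
`E_i ∘ E_j = |X|⁻¹ ∑_h q^h_{i,j} E_h`, where `∘` is the entrywise product. -/
def IsKreinParameters {X : Type*} [Fintype X] {D : ℕ} (E : Fin (D + 1) → Matrix X X ℝ)
    (q : Fin (D + 1) → Fin (D + 1) → Fin (D + 1) → ℝ) : Prop :=
  ∀ i j, Matrix.hadamard (E i) (E j) = (Fintype.card X : ℝ)⁻¹ • ∑ h, q h i j • E h

/-- The ordering `E_0, …, E_D` of the primitive idempotents is `Q`-polynomial: `q^h_{i,j}` is zero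
if one of `h, i, j` is greater than the sum of the other two, and nonzero if one of `h, i, j` is
equal to the sum of the other two. -/
def IsQPolynomial {X : Type*} [Fintype X] {D : ℕ} (E : Fin (D + 1) → Matrix X X ℝ) : Prop :=
  ∃ q : Fin (D + 1) → Fin (D + 1) → Fin (D + 1) → ℝ, IsKreinParameters E q ∧
    ∀ h i j : Fin (D + 1),
      (((i : ℕ) + j < h ∨ (h : ℕ) + j < i ∨ (h : ℕ) + i < j) → q h i j = 0) ∧
      (((h : ℕ) = i + j ∨ (i : ℕ) = h + j ∨ (j : ℕ) = h + i) → q h i j ≠ 0)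

section Complexification

variable {X : Type*} [Fintype X] [DecidableEq X] {G : SimpleGraph X} {x : X}

/-- The real and imaginary parts of an element of `T^ℂ` lie in `T^ℝ`
(that is, `T^ℂ = T^ℝ + i T^ℝ`). -/
theorem re_im_mem {B : Matrix X X ℂ} (hB : B ∈ algebraT ℂ G x) :
    B.map Complex.re ∈ algebraT ℝ G x ∧ B.map Complex.im ∈ algebraT ℝ G x := by
  have hz : ∀ M N : Matrix X X ℝ, M = N → N ∈ algebraT ℝ G x → M ∈ algebraT ℝ G x := by
    rintro M _ rfl h
    exact h
  have hadd : ∀ M N : Matrix X X ℂ,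
      (M.map Complex.re ∈ algebraT ℝ G x ∧ M.map Complex.im ∈ algebraT ℝ G x) →
      (N.map Complex.re ∈ algebraT ℝ G x ∧ N.map Complex.im ∈ algebraT ℝ G x) →
      (M + N).map Complex.re ∈ algebraT ℝ G x ∧ (M + N).map Complex.im ∈ algebraT ℝ G x := by
    rintro M N ⟨h1, h2⟩ ⟨h3, h4⟩
    refine ⟨hz _ _ ?_ (add_mem h1 h3), hz _ _ ?_ (add_mem h2 h4)⟩ <;> ext <;> simp
  have hsmul : ∀ (c : ℂ) (M : Matrix X X ℂ),
      (M.map Complex.re ∈ algebraT ℝ G x ∧ M.map Complex.im ∈ algebraT ℝ G x) →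
      (c • M).map Complex.re ∈ algebraT ℝ G x ∧ (c • M).map Complex.im ∈ algebraT ℝ G x := by
    rintro c M ⟨h1, h2⟩
    refine ⟨hz _ (c.re • M.map Complex.re - c.im • M.map Complex.im) ?_
        (sub_mem (Subalgebra.smul_mem _ h1 _) (Subalgebra.smul_mem _ h2 _)),
      hz _ (c.re • M.map Complex.im + c.im • M.map Complex.re) ?_
        (add_mem (Subalgebra.smul_mem _ h2 _) (Subalgebra.smul_mem _ h1 _))⟩ <;> ext <;> simp
  have hzero : (0 : Matrix X X ℂ).map Complex.re ∈ algebraT ℝ G x ∧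
      (0 : Matrix X X ℂ).map Complex.im ∈ algebraT ℝ G x := by
    refine ⟨hz _ 0 ?_ (zero_mem _), hz _ 0 ?_ (zero_mem _)⟩ <;> ext <;> simp
  refine Algebra.adjoin_induction ?_ ?_ (fun M N _ _ h h' => hadd M N h h') ?_ hB
  · rintro M (hM | hM)
    · refine Submodule.span_induction ?_ hzero (fun M N _ _ h h' => hadd M N h h')
        (fun c M _ h => hsmul c M h) hM
      rintro _ ⟨i, hi, rfl⟩
      refine ⟨hz _ (distMatrix ℝ G i) ?_
        (Algebra.subset_adjoin (Or.inl (Submodule.subset_span ⟨i, hi, rfl⟩))),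
        hz _ 0 ?_ (zero_mem _)⟩ <;> ext y z <;> by_cases h : G.dist y z = i <;>
        simp [distMatrix, h]
    · refine Submodule.span_induction ?_ hzero (fun M N _ _ h h' => hadd M N h h')
        (fun c M _ h => hsmul c M h) hM
      rintro _ ⟨i, hi, rfl⟩
      refine ⟨hz _ (dualIdempotent ℝ G x i) ?_
        (Algebra.subset_adjoin (Or.inr (Submodule.subset_span ⟨i, hi, rfl⟩))),
        hz _ 0 ?_ (zero_mem _)⟩ <;> ext y z <;> by_cases h : G.dist x y = i <;>
        by_cases h' : y = z <;> simp_all [dualIdempotent]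
  · intro c
    rw [Algebra.algebraMap_eq_smul_one]
    refine hsmul c 1 ⟨hz _ 1 ?_ (one_mem _), hz _ 0 ?_ (zero_mem _)⟩ <;> ext y z <;>
      by_cases h : y = z <;> simp [Matrix.one_apply, h]
  · rintro M N _ _ ⟨h1, h2⟩ ⟨h3, h4⟩
    refine ⟨hz _ (M.map Complex.re * N.map Complex.re - M.map Complex.im * N.map Complex.im) ?_
        (sub_mem (mul_mem h1 h3) (mul_mem h2 h4)),
      hz _ (M.map Complex.re * N.map Complex.im + M.map Complex.im * N.map Complex.re) ?_
        (add_mem (mul_mem h1 h4) (mul_mem h2 h3))⟩ <;> ext y z <;>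
      simp [Matrix.mul_apply, Finset.sum_sub_distrib, Finset.sum_add_distrib]

/-- The entrywise real part `T^ℂ → T^ℝ`. -/
def reT (B : algebraT ℂ G x) : algebraT ℝ G x :=
  ⟨(B : Matrix X X ℂ).map Complex.re, (re_im_mem B.2).1⟩

/-- The entrywise imaginary part `T^ℂ → T^ℝ`. -/
def imT (B : algebraT ℂ G x) : algebraT ℝ G x :=
  ⟨(B : Matrix X X ℂ).map Complex.im, (re_im_mem B.2).2⟩

/-- The complexification `W^ℂ = ℂ ⊗_ℝ W` of a `T^ℝ`-module `W`, a vector space over `ℂ`. -/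
abbrev Complexification (W : Submodule (algebraT ℝ G x) (X → ℝ)) : Type _ := ℂ ⊗[ℝ] W

/-! Shortcuts for instance search: these are the usual submodule instances. -/

instance smulT (W : Submodule (algebraT ℝ G x) (X → ℝ)) : SMul (algebraT ℝ G x) W :=
  W.smul

instance moduleT (W : Submodule (algebraT ℝ G x) (X → ℝ)) : Module (algebraT ℝ G x) W :=
  W.module

instance moduleReal (W : Submodule (algebraT ℝ G x) (X → ℝ)) : Module ℝ W :=
  W.module'

/-- The action of `B ∈ T^ℝ` on `W`, as an `ℝ`-linear map. -/
def actT (W : Submodule (algebraT ℝ G x) (X → ℝ)) (B : algebraT ℝ G x) : W →ₗ[ℝ] W where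
  toFun w := B • w
  map_add' := smul_add B
  map_smul' c w := Subtype.ext (Matrix.mulVec_smul (B : Matrix X X ℝ) c (w : X → ℝ))

/-- The action of `B ∈ T^ℂ` on `W^ℂ`, as a `ℂ`-linear map: writing `B = B₁ + i B₂` with
`B₁, B₂ ∈ T^ℝ`, it sends `c ⊗ w` to `c ⊗ B₁ w + i (c ⊗ B₂ w)`. -/
def actC (W : Submodule (algebraT ℝ G x) (X → ℝ)) (B : algebraT ℂ G x) :
    Complexification W →ₗ[ℂ] Complexification W :=
  (actT W (reT B)).baseChange ℂ + Complex.I • (actT W (imT B)).baseChange ℂ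

theorem actC_tmul (W : Submodule (algebraT ℝ G x) (X → ℝ)) (B : algebraT ℂ G x) (c : ℂ) (w : W) :
    actC W B (c ⊗ₜ[ℝ] w) = c ⊗ₜ[ℝ] (reT B • w) + (Complex.I * c) ⊗ₜ[ℝ] (imT B • w) := rfl

/-- The `T^ℂ`-module structure on `W^ℂ`. -/
instance complexificationModule (W : Submodule (algebraT ℝ G x) (X → ℝ)) :
    Module (algebraT ℂ G x) (Complexification W) where
  smul B t := actC W B t
  one_smul t := by
    change actC W 1 t = t
    have hr : reT (1 : algebraT ℂ G x) = 1 := by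
      ext y z
      by_cases h : y = z <;> simp [reT, h]
    have hi : imT (1 : algebraT ℂ G x) = 0 := by
      ext y z
      by_cases h : y = z <;> simp [imT, h]
    induction t using TensorProduct.induction_on with
    | zero => simp
    | add s t hs ht => rw [map_add, hs, ht]
    | tmul c w => rw [actC_tmul, hr, hi, one_smul, zero_smul, TensorProduct.tmul_zero, add_zero]
  mul_smul B C t := by
    change actC W (B * C) t = actC W B (actC W C t)
    have hr : reT (B * C) = reT B * reT C - imT B * imT C := by
      ext y z
      simp [reT, imT, Matrix.mul_apply, Finset.sum_sub_distrib]
    have hi : imT (B * C) = reT B * imT C + imT B * reT C := by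
      ext y z
      simp [reT, imT, Matrix.mul_apply, Finset.sum_add_distrib]
    induction t using TensorProduct.induction_on with
    | zero => simp
    | add s t hs ht => simp only [map_add, hs, ht]
    | tmul c w =>
      have hI : Complex.I * (Complex.I * c) = -c := by
        rw [← mul_assoc, Complex.I_mul_I, neg_one_mul]
      have hs : (reT B * reT C - imT B * imT C) • w
          = (reT B * reT C) • w - (imT B * imT C) • w := sub_smul _ _ w
      have ht : ∀ u v : W, c ⊗ₜ[ℝ] (u - v) = c ⊗ₜ[ℝ] u - c ⊗ₜ[ℝ] v :=
        fun u v => TensorProduct.tmul_sub c u v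
      simp only [actC_tmul, map_add, hr, hi, hs, ht, add_smul, mul_smul, hI,
        TensorProduct.tmul_add, TensorProduct.neg_tmul]
      abel
  smul_zero B := map_zero (actC W B)
  smul_add B s t := map_add (actC W B) s t
  add_smul B C t := by
    change actC W (B + C) t = actC W B t + actC W C t
    have hr : reT (B + C) = reT B + reT C := by
      ext y z
      simp [reT]
    have hi : imT (B + C) = imT B + imT C := by
      ext y z
      simp [imT]
    induction t using TensorProduct.induction_on with
    | zero => simp
    | add s t hs ht =>
      rw [map_add, hs, ht, map_add, map_add]
      abel
    | tmul c w =>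
      simp only [actC_tmul, hr, hi, add_smul, TensorProduct.tmul_add]
      abel
  zero_smul t := by
    change actC W 0 t = 0
    have hr : reT (0 : algebraT ℂ G x) = 0 := by
      ext y z
      simp [reT]
    have hi : imT (0 : algebraT ℂ G x) = 0 := by
      ext y z
      simp [imT]
    induction t using TensorProduct.induction_on with
    | zero => simp
    | add s t hs ht => rw [map_add, hs, ht, add_zero]
    | tmul c w => simp only [actC_tmul, hr, hi, zero_smul, TensorProduct.tmul_zero, add_zero]

end Complexification

end Terwilliger

end

noncomputable section

namespace Terwilliger

variable {X : Type*} [Fintype X] [DecidableEq X] {G : SimpleGraph X} {x : X}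

/-! An isomorphism over `T^ℝ` complexifies, since tensoring with `ℂ` is functorial. Conversely, let
`f : W₁^ℂ → W₂^ℂ` be `T^ℂ`-linear. As `T^ℝ` acts only on the second tensor factor, taking real or
imaginary parts is `T^ℝ`-equivariant, so the real and imaginary parts of `f` on `1 ⊗ W₁` are
`T^ℝ`-maps `W₁ → W₂` (`contractHom`). If `f` does not vanish on `1 ⊗ W₁`, one of them is nonzero,
and Schur's lemma makes it an isomorphism. Irreducibility is thus used only over `ℝ`, where it is
assumed; the modules `W₁^ℂ`, `W₂^ℂ` need not be shown irreducible. -/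

/-! ### Embedding `T^ℝ` in `T^ℂ`. -/

/-- The entrywise inclusion of a real matrix of `T^ℝ` lies in `T^ℂ`. -/
theorem map_ofReal_mem {B : Matrix X X ℝ} (hB : B ∈ algebraT ℝ G x) :
    B.map Complex.ofReal ∈ algebraT ℂ G x := by
  have hsmul : ∀ (c : ℝ) (M : Matrix X X ℝ), M.map Complex.ofReal ∈ algebraT ℂ G x →
      (c • M).map Complex.ofReal ∈ algebraT ℂ G x := by
    intro c M h
    have e : (c • M).map Complex.ofReal = (c : ℂ) • M.map Complex.ofReal := by ext; simp
    exact e ▸ Subalgebra.smul_mem _ h _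
  have hadd : ∀ M N : Matrix X X ℝ, M.map Complex.ofReal ∈ algebraT ℂ G x →
      N.map Complex.ofReal ∈ algebraT ℂ G x →
      (M + N).map Complex.ofReal ∈ algebraT ℂ G x := by
    intro M N h h'
    have e : (M + N).map Complex.ofReal = M.map Complex.ofReal + N.map Complex.ofReal := by
      ext; simp
    exact e ▸ add_mem h h'
  have hzero : (0 : Matrix X X ℝ).map Complex.ofReal ∈ algebraT ℂ G x := by
    have e : (0 : Matrix X X ℝ).map Complex.ofReal = 0 := by ext; simp
    exact e ▸ zero_mem _
  refine Algebra.adjoin_induction ?_ ?_ (fun M N _ _ h h' => hadd M N h h') ?_ hB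
  · rintro M (hM | hM)
    · refine Submodule.span_induction ?_ hzero (fun M N _ _ h h' => hadd M N h h')
        (fun c M _ h => hsmul c M h) hM
      rintro _ ⟨i, hi, rfl⟩
      have e : (distMatrix ℝ G i).map Complex.ofReal = distMatrix ℂ G i := by
        ext y z
        by_cases h : G.dist y z = i <;> simp [distMatrix, h]
      exact e ▸ Algebra.subset_adjoin (Or.inl (Submodule.subset_span ⟨i, hi, rfl⟩))
    · refine Submodule.span_induction ?_ hzero (fun M N _ _ h h' => hadd M N h h')
        (fun c M _ h => hsmul c M h) hM
      rintro _ ⟨i, hi, rfl⟩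
      have e : (dualIdempotent ℝ G x i).map Complex.ofReal = dualIdempotent ℂ G x i := by
        ext y z
        by_cases h : G.dist x y = i <;> by_cases h' : y = z <;> simp_all [dualIdempotent]
      exact e ▸ Algebra.subset_adjoin (Or.inr (Submodule.subset_span ⟨i, hi, rfl⟩))
  · intro c
    rw [Algebra.algebraMap_eq_smul_one]
    refine hsmul c 1 ?_
    have e : (1 : Matrix X X ℝ).map Complex.ofReal = 1 := by
      ext y z
      by_cases h : y = z <;> simp [Matrix.one_apply, h]
    exact e ▸ one_mem _
  · intro M N _ _ h h'
    have e : (M * N).map Complex.ofReal = M.map Complex.ofReal * N.map Complex.ofReal := by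
      ext; simp [Matrix.mul_apply]
    exact e ▸ mul_mem h h'

/-- The inclusion `T^ℝ → T^ℂ`. -/
def ofRealT (B : algebraT ℝ G x) : algebraT ℂ G x :=
  ⟨(B : Matrix X X ℝ).map Complex.ofReal, map_ofReal_mem B.2⟩

theorem reT_ofRealT (B : algebraT ℝ G x) : reT (ofRealT B) = B := by
  ext y z
  simp [reT, ofRealT]

theorem imT_ofRealT (B : algebraT ℝ G x) : imT (ofRealT B) = 0 := by
  ext y z
  simp [imT, ofRealT]

theorem smul_tmul_eq (W : Submodule (algebraT ℝ G x) (X → ℝ)) (B : algebraT ℂ G x) (c : ℂ)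
    (w : W) : B • (c ⊗ₜ[ℝ] w : Complexification W) =
      c ⊗ₜ[ℝ] (reT B • w) + (Complex.I * c) ⊗ₜ[ℝ] (imT B • w) := rfl

theorem ofRealT_smul_tmul (W : Submodule (algebraT ℝ G x) (X → ℝ)) (B : algebraT ℝ G x) (c : ℂ)
    (w : W) : ofRealT B • (c ⊗ₜ[ℝ] w : Complexification W) = c ⊗ₜ[ℝ] (B • w) := by
  rw [smul_tmul_eq, reT_ofRealT, imT_ofRealT, zero_smul, TensorProduct.tmul_zero, add_zero]

/-! ### Real and imaginary parts on `W^ℂ`. -/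

/-- The map `W^ℂ → W` induced by a real functional on `ℂ`. -/
def contract (W : Submodule (algebraT ℝ G x) (X → ℝ)) (φ : ℂ →ₗ[ℝ] ℝ) :
    Complexification W →ₗ[ℝ] W :=
  (TensorProduct.lid ℝ W).toLinearMap ∘ₗ φ.rTensor W

theorem contract_tmul (W : Submodule (algebraT ℝ G x) (X → ℝ)) (φ : ℂ →ₗ[ℝ] ℝ) (c : ℂ) (w : W) :
    contract W φ (c ⊗ₜ[ℝ] w) = φ c • w := rfl

/-- The functional touches only the factor `ℂ` and the real matrix only the factor `W`, so the two
operations commute. This is what makes `contractHom` linear over `T^ℝ`. -/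
theorem contract_ofRealT_smul (W : Submodule (algebraT ℝ G x) (X → ℝ)) (φ : ℂ →ₗ[ℝ] ℝ)
    (B : algebraT ℝ G x) (t : Complexification W) :
    contract W φ (ofRealT B • t) = B • contract W φ t := by
  induction t using TensorProduct.induction_on with
  | zero => rw [smul_zero, map_zero, smul_zero]
  | add s t hs ht => rw [smul_add, map_add, hs, ht, map_add, smul_add]
  | tmul c w =>
    rw [ofRealT_smul_tmul, contract_tmul, contract_tmul]
    exact ((actT W B).map_smul (φ c) w).symm

/-- An element of `W^ℂ` is determined by its real and imaginary parts. -/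
theorem eq_contract_re_add_contract_im (W : Submodule (algebraT ℝ G x) (X → ℝ))
    (t : Complexification W) :
    t = 1 ⊗ₜ[ℝ] contract W Complex.reLm t + Complex.I ⊗ₜ[ℝ] contract W Complex.imLm t := by
  induction t using TensorProduct.induction_on with
  | zero => simp
  | add s t hs ht =>
    -- Each induction hypothesis has its variable on both sides, so only the leftmost occurrence is
    -- expanded.
    nth_rw 1 [hs, ht]
    simp only [map_add, TensorProduct.tmul_add]
    abel
  | tmul c w =>
    -- Moving the real scalars across the tensor sign reduces the claim to `c = Re c • 1 + Im c •
    -- I`.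
    rw [contract_tmul, contract_tmul, ← TensorProduct.smul_tmul, ← TensorProduct.smul_tmul,
      ← TensorProduct.add_tmul]
    congr 1
    apply Complex.ext <;> simp

/-- A `T^ℂ`-linear map `W₁^ℂ → W₂^ℂ` followed by a real functional on `ℂ` restricts to a
`T^ℝ`-linear map `W₁ → W₂`. -/
def contractHom {W₁ W₂ : Submodule (algebraT ℝ G x) (X → ℝ)} (φ : ℂ →ₗ[ℝ] ℝ)
    (f : Complexification W₁ →ₗ[algebraT ℂ G x] Complexification W₂) :
    W₁ →ₗ[algebraT ℝ G x] W₂ where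
  toFun w := contract W₂ φ (f (1 ⊗ₜ[ℝ] w))
  map_add' v w := by rw [TensorProduct.tmul_add, map_add, map_add]
  map_smul' B w := by
    rw [← ofRealT_smul_tmul, map_smul, contract_ofRealT_smul, RingHom.id_apply]

/-! ### Complexifying an isomorphism. -/

/-- The two real structures on `W`, pointwise and through scalar matrices in `T^ℝ`, agree; hence
`T^ℝ`-linear maps are `ℝ`-linear and can be tensored with `ℂ`. -/
theorem algebraMap_smul_eq (W : Submodule (algebraT ℝ G x) (X → ℝ)) (c : ℝ) (w : W) :
    algebraMap ℝ (algebraT ℝ G x) c • w = c • w := by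
  apply Subtype.ext
  change (algebraMap ℝ (Matrix X X ℝ) c) *ᵥ (w : X → ℝ) = c • (w : X → ℝ)
  rw [Algebra.algebraMap_eq_smul_one, Matrix.smul_mulVec, Matrix.one_mulVec]

/-- A `T^ℝ`-linear isomorphism, regarded as an `ℝ`-linear one. -/
def realEquiv {W₁ W₂ : Submodule (algebraT ℝ G x) (X → ℝ)} (e : W₁ ≃ₗ[algebraT ℝ G x] W₂) :
    W₁ ≃ₗ[ℝ] W₂ :=
  { e.toAddEquiv with
    map_smul' := fun c w => by
      change e (c • w) = c • e w
      rw [← algebraMap_smul_eq, map_smul, algebraMap_smul_eq] }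

/-- The complexification of an isomorphism of `T^ℝ`-modules. -/
def complexifyEquiv {W₁ W₂ : Submodule (algebraT ℝ G x) (X → ℝ)}
    (e : W₁ ≃ₗ[algebraT ℝ G x] W₂) :
    Complexification W₁ ≃ₗ[algebraT ℂ G x] Complexification W₂ :=
  { (LinearEquiv.lTensor ℂ (realEquiv e)).toAddEquiv with
    map_smul' := fun B t => by
      change LinearEquiv.lTensor ℂ (realEquiv e) (B • t) =
        B • LinearEquiv.lTensor ℂ (realEquiv e) t
      induction t using TensorProduct.induction_on with
      | zero => rw [smul_zero, map_zero, smul_zero]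
      | add s t hs ht => rw [smul_add, map_add, hs, ht, map_add, smul_add]
      | tmul c w =>
        have he : ∀ (C : algebraT ℝ G x) (v : W₁), realEquiv e (C • v) = C • realEquiv e v :=
          fun C v => e.map_smul C v
        rw [smul_tmul_eq, map_add, LinearEquiv.lTensor_tmul, LinearEquiv.lTensor_tmul,
          LinearEquiv.lTensor_tmul, smul_tmul_eq, he, he] }

/-! ### Descent by Schur's lemma. -/

/-- Irreducible `T^ℝ`-modules with a nonzero `T^ℂ`-linear map between their complexifications are
isomorphic. -/
theorem nonempty_equiv_of_complexification_ne_zero {W₁ W₂ : Submodule (algebraT ℝ G x) (X → ℝ)}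
    [IsSimpleModule (algebraT ℝ G x) W₁] [IsSimpleModule (algebraT ℝ G x) W₂]
    (f : Complexification W₁ →ₗ[algebraT ℂ G x] Complexification W₂) {w : W₁}
    (hw : f (1 ⊗ₜ[ℝ] w) ≠ 0) : Nonempty (W₁ ≃ₗ[algebraT ℝ G x] W₂) := by
  -- The functionals `Re` and `Im` suffice: together they determine `f (1 ⊗ w)`, which is nonzero.
  have key : ∃ φ, contractHom φ f ≠ 0 := by
    by_contra! h
    have hre : contract W₂ Complex.reLm (f (1 ⊗ₜ[ℝ] w)) = 0 :=
      LinearMap.congr_fun (h Complex.reLm) w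
    have him : contract W₂ Complex.imLm (f (1 ⊗ₜ[ℝ] w)) = 0 :=
      LinearMap.congr_fun (h Complex.imLm) w
    apply hw
    rw [eq_contract_re_add_contract_im W₂ (f (1 ⊗ₜ[ℝ] w)), hre, him, TensorProduct.tmul_zero,
      TensorProduct.tmul_zero, add_zero]
  obtain ⟨φ, hφ⟩ := key
  have hb : Function.Bijective (contractHom φ f) :=
    -- Schur's lemma for the two simple `T^ℝ`-modules.
    @LinearMap.bijective_of_ne_zero (algebraT ℝ G x) _ W₁ _ _ W₂ _ _ _ _ (contractHom φ f) hφ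
  exact ⟨LinearEquiv.ofBijective (contractHom φ f) hb⟩

/-- Taking the real part recovers `w` from `1 ⊗ w`. -/
theorem one_tmul_ne_zero (W : Submodule (algebraT ℝ G x) (X → ℝ)) {w : W} (hw : w ≠ 0) :
    (1 ⊗ₜ[ℝ] w : Complexification W) ≠ 0 := by
  intro h
  apply hw
  have := congrArg (contract W Complex.reLm) h
  rwa [contract_tmul, map_zero, Complex.reLm_coe, Complex.one_re, one_smul] at this

end Terwilliger

end

theorem theorem1p4 {X : Type*} [Fintype X] [DecidableEq X] (G : SimpleGraph X)
    (hG : Terwilliger.IsDistanceRegular G) (hD : 3 ≤ G.diam)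
    (E : Fin (G.diam + 1) → Matrix X X ℝ)
    (hE : Terwilliger.IsPrimitiveIdempotentOrdering G E)
    (hQ : Terwilliger.IsQPolynomial E) (x : X)
    (W₁ W₂ : Submodule (Terwilliger.algebraT ℝ G x) (X → ℝ))
    (hW₁ : IsSimpleModule (Terwilliger.algebraT ℝ G x) W₁)
    (hW₂ : IsSimpleModule (Terwilliger.algebraT ℝ G x) W₂) :
    Nonempty (W₁ ≃ₗ[Terwilliger.algebraT ℝ G x] W₂) ↔
      Nonempty (Terwilliger.Complexification W₁ ≃ₗ[Terwilliger.algebraT ℂ G x]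
        Terwilliger.Complexification W₂) := by
  refine ⟨fun ⟨e⟩ => ⟨Terwilliger.complexifyEquiv e⟩, fun ⟨f⟩ => ?_⟩
  have := IsSimpleModule.nontrivial (Terwilliger.algebraT ℝ G x) W₁
  obtain ⟨w, hw⟩ := exists_ne (0 : W₁)
  exact Terwilliger.nonempty_equiv_of_complexification_ne_zero f.toLinearMap
    (f.map_ne_zero_iff.mpr (Terwilliger.one_tmul_ne_zero W₁ hw))
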